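/- Let $d\ge 0$, and equip $\mathbb R^d$ and its dual (identified with $\mathbb R^d$) with the Euclidean norm. Let $H:\mathbb R^d\times\mathbb R^d\to\mathbb R$, $(q,p)\mapsto H(q,p)$, be an autonomous Hamiltonian of class $C^2$ for which there are constants $m>0$ and $M$ such that, for all $(q,p)$, (1) $\|d^2H(q,p)\|\le M$; (2) $\partial^2_{pp}H(q,p)\ge m\,\mathrm{Id}$ in the sense of quadratic forms; (3) $\frac m2|p|^2-M\le H(q,p)\le \frac M2|p|^2+M$. An orbit is a solution of $\dot q=\partial_pH(q,p)$, $\dot p=-\partial_qH(q,p)$. Under these hypotheses there is $\sigma>0$ such that, for $0<t\le\sigma$, any two points $q_0,q_1$ are joined by exactly one orbit with $q(0)=q_0$ and $q(t)=q_1$; let $S^t(q_0,q_1)=\int_0^t p\cdot\dot q-H(q,p)\,ds$ be the action of this orbit. For $t>0$ the minimal action is $$A^t(q_0,q_1)=\min_{\theta_1,\dots,\theta_{n-1}}\big(S^{t/n}(q_0,\theta_1)+S^{t/n}(\theta_1,\theta_2)+\dots+S^{t/n}(\theta_{n-1},q_1)\big),$$ where $n\ge 1$ is any integer such that $t/n<\sigma$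 (the value does not depend on $n$). For $u:\mathbb R^d\to\mathbb R$ put $T^tu(q)=\inf_{\theta\in\mathbb R^d}\big(u(\theta)+A^t(\theta,q)\big)\in[-\infty,\infty)$ for $t>0$, and $T^0u=u$. A function $u:\mathbb R^d\to\mathbb R$ is a viscosity sub-solution of $H(q,du(q))=a$ if it is upper semi-continuous and $H(q,dv(q))\le a$ for every $C^1$ function $v:\mathbb R^d\to\mathbb R$ and every point $q$ at which $v-u$ has a local minimum. Then, for every $a\in\mathbb R$ and every function $u:\mathbb R^d\to\mathbb R$, the following properties are equivalent: 1. $u$ is Lipschitz and, for almost every $q$, $u$ is differentiable at $q$ with $H(q,du(q))\le a$. 2. $u(q_1)-u(q_0)\le A^t(q_0,q_1)+at$ for all $q_0,q_1\in\mathbb R^d$ and all $t>0$. 3. $u\le T^tu+ta$ for all $t\ge0$. 4. $u$ is a viscosity sub-solution of $H(q,du(q))=a$. 5. $u$ is Lipschitz and $H(q,du(q))\le a$ at each point $q$ of differentiability of $u$. -/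

import Mathlib

open MeasureTheory

noncomputable section

namespace WeakKAM

/-- The configuration space `ℝ^d` with its Euclidean norm. Its dual is identified with `ℝ^d` through
the dot product, so that differentials are represented by gradients. -/
abbrev Conf (d : ℕ) : Type := EuclideanSpace ℝ (Fin d)

variable {d : ℕ}

/-- The partial gradient `∂_q H (q, p)`. -/
def dq (H : Conf d → Conf d → ℝ) (q p : Conf d) : Conf d := gradient (fun q' => H q' p) q

/-- The partial gradient `∂_p H (q, p)`. -/
def dp (H : Conf d → Conf d → ℝ) (q p : Conf d) : Conf d := gradient (H q) p

/-- The standing hypotheses on an autonomous Hamiltonian `H(q, p)`, with constants `m` and `M`. -/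
structure IsUniformlyConvexHamiltonian (H : Conf d → Conf d → ℝ) (m M : ℝ) : Prop where
  /-- `H` is of class `C²`. -/
  contDiff : ContDiff ℝ 2 (Function.uncurry H)
  /-- `‖d²H‖ ≤ M`. -/
  hessian_le : ∀ x, ‖fderiv ℝ (fderiv ℝ (Function.uncurry H)) x‖ ≤ M
  m_pos : 0 < m
  /-- `∂²_pp H ≥ m Id` in the sense of quadratic forms. -/
  convex : ∀ q p v, m * ‖v‖ ^ 2 ≤ fderiv ℝ (fderiv ℝ (H q)) p v v
  lower_bound : ∀ q p, m / 2 * ‖p‖ ^ 2 - M ≤ H q p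
  upper_bound : ∀ q p, H q p ≤ M / 2 * ‖p‖ ^ 2 + M

/-- `s ↦ (q s, p s)` solves the Hamiltonian system
`q' = ∂_p H (q, p)`, `p' = - ∂_q H (q, p)` on `ℝ`. -/
def IsOrbit (H : Conf d → Conf d → ℝ) (q p : ℝ → Conf d) : Prop :=
  ∀ s, HasDerivAt q (dp H (q s) (p s)) s ∧ HasDerivAt p (-dq H (q s) (p s)) s

/-- `x = (q, p)` is an orbit with `q 0 = q₀` and `q t = q₁`. -/
def Connects (H : Conf d → Conf d → ℝ) (t : ℝ) (q₀ q₁ : Conf d)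
    (x : (ℝ → Conf d) × (ℝ → Conf d)) : Prop :=
  IsOrbit H x.1 x.2 ∧ x.1 0 = q₀ ∧ x.1 t = q₁

/-- The Hamiltonian action `∫₀ᵗ p · q' - H(q, p) ds` of a curve. -/
def action (H : Conf d → Conf d → ℝ) (t : ℝ) (x : (ℝ → Conf d) × (ℝ → Conf d)) : ℝ :=
  ∫ s in (0 : ℝ)..t, (inner ℝ (x.2 s) (deriv x.1 s) - H (x.1 s) (x.2 s))

/-- Whenever `0 < t ≤ σ`, any two points are joined in time `t` by exactly one orbit. -/
def UniqueOrbits (H : Conf d → Conf d → ℝ) (σ : ℝ) : Prop :=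
  ∀ t, 0 < t → t ≤ σ → ∀ q₀ q₁, ∃! x, Connects H t q₀ q₁ x

open Classical in
/-- The generating function `S^t(q₀, q₁)`: the action of the orbit which joins `q₀` to `q₁` in
time `t`. It is meaningful for the small times for which this orbit exists and is unique. -/
def genFun (H : Conf d → Conf d → ℝ) (t : ℝ) (q₀ q₁ : Conf d) : ℝ :=
  if h : ∃ x, Connects H t q₀ q₁ x then action H t h.choose else 0

/-- The minimum over `θ₁, …, θₙ₋₁` of
`S^{t/n}(q₀, θ₁) + S^{t/n}(θ₁, θ₂) + ⋯ + S^{t/n}(θₙ₋₁, q₁)`;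
here `θ₀ = q₀` and `θₙ = q₁`. -/
def brokenMin (H : Conf d → Conf d → ℝ) (n : ℕ) (t : ℝ) (q₀ q₁ : Conf d) : ℝ :=
  ⨅ θ : {θ : Fin (n + 1) → Conf d // θ 0 = q₀ ∧ θ (Fin.last n) = q₁},
    ∑ i : Fin n, genFun H (t / n) (θ.1 i.castSucc) (θ.1 i.succ)

/-- `n ≥ 1` and `t / n < σ`, where any two points are joined by a unique orbit in times up
to `σ`. -/
def Admissible (H : Conf d → Conf d → ℝ) (t : ℝ) (n : ℕ) : Prop :=
  1 ≤ n ∧ ∃ σ, t / n < σ ∧ UniqueOrbits H σ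

/-- The minimal action `A^t(q₀, q₁)` for `t > 0`. It is computed with the smallest admissible
number of pieces (the value is the same for every admissible number). -/
def minAction (H : Conf d → Conf d → ℝ) (t : ℝ) (q₀ q₁ : Conf d) : ℝ :=
  brokenMin H (sInf {n | Admissible H t n}) t q₀ q₁

open Classical in
/-- The Lax-Oleinik operator `T^t u (q) = inf_θ (u θ + A^t(θ, q))` for `t > 0`, and `T^0 = Id`.
The infimum may be `-∞`. -/
def laxOleinik (H : Conf d → Conf d → ℝ) (t : ℝ) (u : Conf d → ℝ) (q : Conf d) : EReal :=
  if t = 0 then (u q : EReal) else ⨅ θ : Conf d, ((u θ + minAction H t θ q : ℝ) : EReal)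

/-- `u` is a viscosity sub-solution of `H(q, du(q)) = a`: it is upper semi-continuous, and
`H(q, dv(q)) ≤ a` whenever a `C¹` function `v` touches `u` from above at `q`. -/
def IsViscositySubsolution (H : Conf d → Conf d → ℝ) (a : ℝ) (u : Conf d → ℝ) : Prop :=
  UpperSemicontinuous u ∧
    ∀ v : Conf d → ℝ, ContDiff ℝ 1 v → ∀ q, IsLocalMin (fun θ => v θ - u θ) q →
      H q (gradient v q) ≤ a

end WeakKAM

end

/-! Write `L = p · ∂_p H - H` (`actionDensity`). Convexity of `H` in `p` gives Fenchel's inequality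
`w · ∂_p H(q, p) ≤ L + H(q, w)`, with equality at `w = p`. For 1 → 2, take `w = du` and integrate
along an orbit: the increment of `u` is at most the action plus `a t`. An almost everywhere
inequality may fail all along one orbit, so the orbit is shifted by a small vector chosen through
Fubini (`sub_le_action_of_ae`); summing over the links of a broken orbit gives 2. Property 3 is 2
after taking the infimum over the starting point. For 2 → 4, if `v` touches `u` from above at `x`,
domination along the orbit arriving at `(x, dv(x))`, differentiated at arrival, is the case of
equality and yields `H(x, dv(x)) ≤ a` (`le_of_dominated`). Moreover `u` is Lipschitz, since nearby
points are joined in time equal to their distance with bounded momentum. For 4 → 5, coercivity of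
`H` keeps steep cones from touching `u` away from their vertex, and a quadratic penalty produces
touching points near any point of differentiability, with gradients near `du`. Rademacher's theorem
gives 5 → 1. The dynamics enter through `twist`: for short times the final position is strongly
monotone in the initial momentum, whence existence, uniqueness and momentum bounds for connecting
orbits. -/

noncomputable section

/-! ### The Hamiltonian vector field: Lipschitz bounds, convexity, linear growth. -/

namespace WeakKAM

variable {d : ℕ}

/-- The Hamiltonian vector field `(∂_p H, -∂_q H)` on phase space. -/
def hamField (H : Conf d → Conf d → ℝ) (x : Conf d × Conf d) : Conf d × Conf d :=
  (dp H x.1 x.2, -dq H x.1 x.2)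

namespace IsUniformlyConvexHamiltonian

variable {H : Conf d → Conf d → ℝ} {m M : ℝ} (hH : IsUniformlyConvexHamiltonian H m M)
include hH

theorem bound_nonneg : 0 ≤ M :=
  (norm_nonneg (fderiv ℝ (fderiv ℝ (Function.uncurry H)) 0)).trans (hH.hessian_le 0)

theorem continuous_uncurry : Continuous (Function.uncurry H) := hH.contDiff.continuous

theorem hasFDerivAt_uncurry (x : Conf d × Conf d) :
    HasFDerivAt (Function.uncurry H) (fderiv ℝ (Function.uncurry H) x) x :=
  (hH.contDiff.differentiable (by norm_num) x).hasFDerivAt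

theorem hasFDerivAt_right (q p : Conf d) : HasFDerivAt (H q)
    ((fderiv ℝ (Function.uncurry H) (q, p)).comp (ContinuousLinearMap.inr ℝ _ _)) p :=
  (hH.hasFDerivAt_uncurry (q, p)).comp p (hasFDerivAt_prodMk_right q p)

theorem hasFDerivAt_left (q p : Conf d) : HasFDerivAt (fun q' => H q' p)
    ((fderiv ℝ (Function.uncurry H) (q, p)).comp (ContinuousLinearMap.inl ℝ _ _)) q :=
  HasFDerivAt.comp (g := Function.uncurry H) (f := fun q' => (q', p)) q
    (hH.hasFDerivAt_uncurry (q, p)) (hasFDerivAt_prodMk_left q p)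

theorem inner_dp (q p w : Conf d) :
    inner ℝ (dp H q p) w = fderiv ℝ (Function.uncurry H) (q, p) (0, w) := by
  have := (hH.hasFDerivAt_right q p).fderiv
  rw [dp, gradient, InnerProductSpace.toDual_symm_apply, this]; rfl

theorem inner_dq (q p w : Conf d) :
    inner ℝ (dq H q p) w = fderiv ℝ (Function.uncurry H) (q, p) (w, 0) := by
  have := (hH.hasFDerivAt_left q p).fderiv
  rw [dq, gradient, InnerProductSpace.toDual_symm_apply, this]; rfl

/-- Written through the total derivative, the field inherits its Lipschitz constant and its
smoothness from the Hessian bound and the `C²` hypothesis. -/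
theorem hamField_eq : hamField H = fun x =>
    ((InnerProductSpace.toDual ℝ (Conf d)).symm
      ((fderiv ℝ (Function.uncurry H) x).comp (ContinuousLinearMap.inr ℝ _ _)),
     -(InnerProductSpace.toDual ℝ (Conf d)).symm
      ((fderiv ℝ (Function.uncurry H) x).comp (ContinuousLinearMap.inl ℝ _ _))) := by
  funext x
  simp only [hamField, dp, dq, gradient]
  rw [(hH.hasFDerivAt_left x.1 x.2).fderiv, (hH.hasFDerivAt_right x.1 x.2).fderiv]

theorem norm_fderiv_sub_le (x y : Conf d × Conf d) :
    ‖fderiv ℝ (Function.uncurry H) x - fderiv ℝ (Function.uncurry H) y‖ ≤ M * ‖x - y‖ :=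
  convex_univ.norm_image_sub_le_of_norm_fderiv_le (𝕜 := ℝ)
    (fun z _ => (hH.contDiff.fderiv_right (m := 1) (by norm_num)).differentiable (by norm_num) z)
    (fun z _ => hH.hessian_le z) (Set.mem_univ _) (Set.mem_univ _)

theorem norm_hamField_sub_le (x y : Conf d × Conf d) :
    ‖hamField H x - hamField H y‖ ≤ M * ‖x - y‖ := by
  have key := hH.norm_fderiv_sub_le x y
  rw [hH.hamField_eq]
  refine norm_prod_le_iff.2 ⟨?_, ?_⟩
  · simp only [Prod.fst_sub, ← map_sub, LinearIsometryEquiv.norm_map]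
    rw [← ContinuousLinearMap.sub_comp]
    refine (ContinuousLinearMap.opNorm_comp_le _ _).trans (le_trans ?_ key)
    exact mul_le_of_le_one_right (norm_nonneg _) (ContinuousLinearMap.norm_inr_le_one ℝ _ _)
  · simp only [Prod.snd_sub, neg_sub_neg, ← map_sub, LinearIsometryEquiv.norm_map]
    rw [← ContinuousLinearMap.sub_comp]
    refine (ContinuousLinearMap.opNorm_comp_le _ _).trans (le_trans ?_ key)
    rw [norm_sub_rev]
    exact mul_le_of_le_one_right (norm_nonneg _) (ContinuousLinearMap.norm_inl_le_one ℝ _ _)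

theorem lipschitzWith_hamField : LipschitzWith M.toNNReal (hamField H) :=
  LipschitzWith.of_dist_le_mul fun x y => by
    rw [Real.coe_toNNReal _ hH.bound_nonneg, dist_eq_norm, dist_eq_norm]
    exact hH.norm_hamField_sub_le x y

theorem norm_dp_sub_le (x y : Conf d × Conf d) :
    ‖dp H x.1 x.2 - dp H y.1 y.2‖ ≤ M * ‖x - y‖ :=
  (norm_fst_le (hamField H x - hamField H y)).trans (hH.norm_hamField_sub_le x y)

theorem contDiff_hamField : ContDiff ℝ 1 (hamField H) := by
  have h := hH.contDiff.fderiv_right (m := 1) (by norm_num)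
  rw [hH.hamField_eq]
  refine ContDiff.prodMk ?_ (ContDiff.neg ?_)
  · exact (LinearIsometryEquiv.contDiff _).comp (h.clm_comp contDiff_const)
  · exact (LinearIsometryEquiv.contDiff _).comp (h.clm_comp contDiff_const)

theorem hasDerivAt_line (q p w : Conf d) (s : ℝ) :
    HasDerivAt (fun s : ℝ => H q (p + s • w)) (inner ℝ (dp H q (p + s • w)) w) s := by
  have h1 : HasDerivAt (fun s : ℝ => p + s • w) w s := by
    simpa using ((hasDerivAt_id s).smul_const w).const_add p
  rw [hH.inner_dp]
  exact (hH.hasFDerivAt_right q _).comp_hasDerivAt s h1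

/-- The partial gradient `∂_p H` is strongly monotone. -/
theorem strongly_monotone (q p w : Conf d) :
    m * ‖w‖ ^ 2 ≤ inner ℝ (dp H q (p + w) - dp H q p) w := by
  have hC : ContDiff ℝ 2 (H q) := hH.contDiff.comp (contDiff_const.prodMk contDiff_id)
  have h1 (s : ℝ) : HasDerivAt (fun s : ℝ => p + s • w) w s := by
    simpa using ((hasDerivAt_id s).smul_const w).const_add p
  have h2 (s : ℝ) : HasDerivAt (fun s : ℝ => fderiv ℝ (H q) (p + s • w) w)
      (fderiv ℝ (fderiv ℝ (H q)) (p + s • w) w w) s := by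
    have h3 := ((hC.fderiv_right (m := 1) (by norm_num)).differentiable (by norm_num)
      (p + s • w)).hasFDerivAt.comp_hasDerivAt s (h1 s)
    simpa using h3.clm_apply (hasDerivAt_const s w)
  obtain ⟨c, -, hc⟩ := exists_hasDerivAt_eq_slope _ _ zero_lt_one
    (fun s _ => (h2 s).continuousAt.continuousWithinAt) (fun s _ => h2 s)
  have h4 := hH.convex q (p + c • w) w
  rw [hc] at h4
  simp only [one_smul, zero_smul, add_zero, sub_zero, div_one] at h4
  rw [inner_sub_left]
  simpa only [dp, gradient, InnerProductSpace.toDual_symm_apply] using h4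

/-- `H` is convex in `p`: the graph lies above its tangents. -/
theorem add_inner_le (q p p' : Conf d) : H q p + inner ℝ (dp H q p) (p' - p) ≤ H q p' := by
  set w := p' - p with hw
  obtain ⟨c, hc, h⟩ := exists_hasDerivAt_eq_slope _ _ zero_lt_one
    (fun s _ => (hH.hasDerivAt_line q p w s).continuousAt.continuousWithinAt)
    (fun s _ => hH.hasDerivAt_line q p w s)
  simp only [one_smul, zero_smul, add_zero, sub_zero, div_one, hw, add_sub_cancel] at h
  have h2 := hH.strongly_monotone q p (c • w)
  rw [inner_smul_right, inner_sub_left] at h2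
  have h3 : 0 ≤ m * ‖c • w‖ ^ 2 := by have := hH.m_pos; positivity
  have h4 : inner ℝ (dp H q p) w ≤ inner ℝ (dp H q (p + c • w)) w := by
    by_contra hlt
    nlinarith [hc.1]
  linarith

/-- The Hessian bound controls only variations of `dH`; its size at `p = 0` comes from pinching `H`
between quadratics. The tangent at `0`, evaluated at the unit vector along the gradient, gives `5 *
M / 2`. -/
theorem norm_dp_zero_le (q : Conf d) : ‖dp H q 0‖ ≤ 3 * M := by
  have hM := hH.bound_nonneg
  rcases eq_or_ne (dp H q 0) 0 with h | h
  · rw [h, norm_zero]; positivity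
  have hn : ‖dp H q 0‖ ≠ 0 := norm_ne_zero_iff.2 h
  have h1 := hH.add_inner_le q 0 (‖dp H q 0‖⁻¹ • dp H q 0)
  rw [sub_zero, inner_smul_right, real_inner_self_eq_norm_sq, pow_two, inv_mul_cancel_left₀ hn]
    at h1
  have h2 := hH.upper_bound q (‖dp H q 0‖⁻¹ • dp H q 0)
  have h3 := hH.lower_bound q 0
  rw [norm_smul, norm_inv, norm_norm, inv_mul_cancel₀ hn] at h2
  simp at h3
  linarith

theorem norm_dq_zero_le (q : Conf d) : ‖dq H q 0‖ ≤ 3 * M := by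
  have hM := hH.bound_nonneg
  rcases eq_or_ne (dq H q 0) 0 with h | h
  · rw [h, norm_zero]; positivity
  have hn : ‖dq H q 0‖ ≠ 0 := norm_ne_zero_iff.2 h
  set w := ‖dq H q 0‖⁻¹ • dq H q 0 with hw
  have hw1 : ‖w‖ = 1 := by rw [hw, norm_smul, norm_inv, norm_norm, inv_mul_cancel₀ hn]
  have h1 (s : ℝ) : HasDerivAt (fun s : ℝ => q + s • w) w s := by
    simpa using ((hasDerivAt_id s).smul_const w).const_add q
  have h2 (s : ℝ) : HasDerivAt (fun s : ℝ => H (q + s • w) 0)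
      (inner ℝ (dq H (q + s • w) 0) w) s := by
    rw [hH.inner_dq]
    exact (hH.hasFDerivAt_left _ _).comp_hasDerivAt s (h1 s)
  -- `H` is not convex in `q`: over a unit segment the mean slope is at most `2 * M`, and the
  -- derivative varies by at most `M`.
  obtain ⟨c, hc, h⟩ := exists_hasDerivAt_eq_slope _ _ zero_lt_one
    (fun s _ => (h2 s).continuousAt.continuousWithinAt) (fun s _ => h2 s)
  simp only [one_smul, zero_smul, add_zero, sub_zero, div_one] at h
  have h3 : inner ℝ (dq H q 0) w = ‖dq H q 0‖ := by
    rw [hw, inner_smul_right, real_inner_self_eq_norm_sq, pow_two, inv_mul_cancel_left₀ hn]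
  have h4 : ‖dq H q 0 - dq H (q + c • w) 0‖ ≤ M := by
    have h5 := (norm_snd_le _).trans
      (hH.norm_hamField_sub_le (q + c • w, 0) (q, 0))
    simp only [hamField, neg_sub_neg, Prod.mk_sub_mk, add_sub_cancel_left, sub_self,
      Prod.norm_mk, norm_zero, norm_smul, hw1] at h5
    rw [mul_one, max_eq_left (norm_nonneg _), Real.norm_eq_abs, abs_of_pos hc.1] at h5
    exact h5.trans (by nlinarith [hc.2])
  have h6 : inner ℝ (dq H q 0 - dq H (q + c • w) 0) w ≤ M := by
    refine (real_inner_le_norm _ _).trans ?_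
    rwa [hw1, mul_one]
  rw [inner_sub_left] at h6
  have h7 := hH.upper_bound (q + w) 0
  have h8 := hH.lower_bound q 0
  simp at h7 h8
  linarith

theorem norm_hamField_le (q p : Conf d) : ‖hamField H (q, p)‖ ≤ 3 * M + M * ‖p‖ := by
  have h0 : ‖hamField H (q, 0)‖ ≤ 3 * M :=
    norm_prod_le_iff.2 ⟨hH.norm_dp_zero_le q, by simpa [hamField] using hH.norm_dq_zero_le q⟩
  have h1 := hH.norm_hamField_sub_le (q, p) (q, 0)
  simp only [Prod.mk_sub_mk, sub_self, sub_zero, Prod.norm_mk, norm_zero] at h1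
  rw [max_eq_right (norm_nonneg _)] at h1
  have h2 := norm_le_norm_add_norm_sub' (hamField H (q, p)) (hamField H (q, 0))
  linarith

end IsUniformlyConvexHamiltonian

end WeakKAM

end

/-! ### Completeness of the flow and Gronwall estimates. -/

noncomputable section

/-- A `C¹` globally Lipschitz vector field on a Banach space is complete. -/
theorem exists_forall_hasDerivAt_of_lipschitzWith {E : Type*} [NormedAddCommGroup E]
    [NormedSpace ℝ E] [CompleteSpace E] {f : E → E} (hf : ContDiff ℝ 1 f) {K : NNReal}
    (hK : LipschitzWith K f) (x : E) :
    ∃ γ : ℝ → E, γ 0 = x ∧ ∀ s, HasDerivAt γ (f (γ s)) s := by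
  -- On the ball of radius `‖f x‖ + 1` the field is at most `(K + 1) * (‖f x‖ + 1)`, so the
  -- existence time does not depend on `x` and local solutions extend to all of `ℝ`.
  set ε : ℝ := 1 / (2 * (K + 1)) with hε
  have hε0 : 0 < ε := by positivity
  have hloc : ∀ x : E, ∃ γ : ℝ → E, γ 0 = x ∧
      IsMIntegralCurveOn (I := modelWithCornersSelf ℝ E) γ f (Set.Ioo (-ε) ε) := by
    intro x
    have h0 : (0 : ℝ) ∈ Set.Icc (-ε) ε := ⟨by linarith, hε0.le⟩
    have hP : IsPicardLindelof (fun _ => f) (⟨0, h0⟩ : Set.Icc (-ε) ε) x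
        (‖f x‖₊ + 1) 0 (‖f x‖₊ + K * (‖f x‖₊ + 1)) K := by
      refine IsPicardLindelof.of_time_independent (fun y hy => ?_) (hK.lipschitzOnWith) ?_
      · have h1 := hK.dist_le_mul y x
        rw [dist_eq_norm] at h1
        have h2 := norm_le_norm_add_norm_sub' (f y) (f x)
        rw [Metric.mem_closedBall] at hy
        push_cast at hy ⊢
        have h3 := mul_le_mul_of_nonneg_left hy K.2
        simp only [NNReal.val_eq_coe] at h3
        linarith
      · simp only [sub_zero, zero_sub, neg_neg, max_self]
        push_cast
        rw [hε, mul_one_div, div_le_iff₀ (by positivity)]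
        nlinarith [norm_nonneg (f x), K.2, mul_nonneg K.2 (norm_nonneg (f x))]
    obtain ⟨γ, hγ0, hγ⟩ := hP.exists_eq_forall_mem_Icc_hasDerivWithinAt₀
    refine ⟨γ, hγ0, fun s hs => ?_⟩
    exact ((hγ s (Set.Ioo_subset_Icc_self hs)).mono
      Set.Ioo_subset_Icc_self).hasFDerivWithinAt.hasMFDerivWithinAt
  obtain ⟨γ, hγ0, hγ⟩ := exists_isMIntegralCurve_of_isMIntegralCurveOn
    (I := modelWithCornersSelf ℝ E) (v := f) (contMDiff_vectorSpace_iff_contDiff.2 hf) hε0 hloc x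
  refine ⟨γ, hγ0, fun s => ?_⟩
  have h : HasFDerivAt γ ((1 : ℝ →L[ℝ] ℝ).smulRight (f (γ s))) s :=
    hasMFDerivAt_iff_hasFDerivAt.1 (hγ s)
  simpa using h.hasDerivAt

namespace WeakKAM

variable {d : ℕ} {H : Conf d → Conf d → ℝ} {m M : ℝ}

theorem IsOrbit.hasDerivAt_prod {q p : ℝ → Conf d} (h : IsOrbit H q p) (s : ℝ) :
    HasDerivAt (fun s => (q s, p s)) (hamField H (q s, p s)) s :=
  (h s).1.prodMk (h s).2

theorem IsOrbit.comp_add_const {q p : ℝ → Conf d} (h : IsOrbit H q p) (t : ℝ) :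
    IsOrbit H (fun s => q (s + t)) (fun s => p (s + t)) := fun s =>
  ⟨(h (s + t)).1.comp_add_const s t, (h (s + t)).2.comp_add_const s t⟩

namespace IsUniformlyConvexHamiltonian

variable (hH : IsUniformlyConvexHamiltonian H m M)
include hH

theorem exists_isOrbit (q₀ p₀ : Conf d) : ∃ q p, IsOrbit H q p ∧ q 0 = q₀ ∧ p 0 = p₀ := by
  obtain ⟨γ, h0, hγ⟩ := exists_forall_hasDerivAt_of_lipschitzWith hH.contDiff_hamField
    hH.lipschitzWith_hamField (q₀, p₀)
  refine ⟨fun s => (γ s).1, fun s => (γ s).2, fun s => ⟨?_, ?_⟩, by simp [h0], by simp [h0]⟩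
  · exact hasFDerivAt_fst.comp_hasDerivAt s (hγ s)
  · exact hasFDerivAt_snd.comp_hasDerivAt s (hγ s)

theorem isOrbit_unique {q p q' p' : ℝ → Conf d} (h : IsOrbit H q p) (h' : IsOrbit H q' p')
    (hq : q 0 = q' 0) (hp : p 0 = p' 0) : q = q' ∧ p = p' := by
  have h1 : (fun s => (q s, p s)) = fun s => (q' s, p' s) :=
    ODE_solution_unique_univ (v := fun _ => hamField H) (s := fun _ => Set.univ) (t₀ := 0)
      (K := M.toNNReal) (fun _ => hH.lipschitzWith_hamField.lipschitzOnWith)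
      (fun s => ⟨h.hasDerivAt_prod s, Set.mem_univ _⟩)
      (fun s => ⟨h'.hasDerivAt_prod s, Set.mem_univ _⟩) (by simp [hq, hp])
  exact ⟨funext fun s => congrArg Prod.fst (congrFun h1 s),
    funext fun s => congrArg Prod.snd (congrFun h1 s)⟩

/-- Two orbits diverge at most exponentially. -/
theorem norm_orbit_sub_le {q p q' p' : ℝ → Conf d} (h : IsOrbit H q p) (h' : IsOrbit H q' p')
    {s : ℝ} (hs : 0 ≤ s) :
    ‖(q s, p s) - (q' s, p' s)‖ ≤ ‖(q 0, p 0) - (q' 0, p' 0)‖ * Real.exp (M * s) := by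
  have h1 := dist_le_of_trajectories_ODE (v := fun _ => hamField H) (K := M.toNNReal)
    (a := 0) (b := s) (f := fun s => (q s, p s)) (g := fun s => (q' s, p' s))
    (δ := ‖(q 0, p 0) - (q' 0, p' 0)‖) (fun _ => hH.lipschitzWith_hamField)
    (fun r _ => (h.hasDerivAt_prod r).continuousAt.continuousWithinAt)
    (fun r _ => (h.hasDerivAt_prod r).hasDerivWithinAt)
    (fun r _ => (h'.hasDerivAt_prod r).continuousAt.continuousWithinAt)
    (fun r _ => (h'.hasDerivAt_prod r).hasDerivWithinAt) (dist_eq_norm _ _).le s ⟨hs, le_rfl⟩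
  rwa [sub_zero, Real.coe_toNNReal _ hH.bound_nonneg, dist_eq_norm] at h1

/-- The difference of two orbits stays close to its initial value. -/
theorem norm_orbit_sub_sub_le {q p q' p' : ℝ → Conf d} (h : IsOrbit H q p)
    (h' : IsOrbit H q' p') {s : ℝ} (hs : 0 ≤ s) :
    ‖((q s, p s) - (q' s, p' s)) - ((q 0, p 0) - (q' 0, p' 0))‖ ≤
      M * (‖(q 0, p 0) - (q' 0, p' 0)‖ * Real.exp (M * s)) * s := by
  have hM := hH.bound_nonneg
  have h1 := norm_image_sub_le_of_norm_deriv_le_segment' (a := 0) (b := s)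
    (f := fun s => (q s, p s) - (q' s, p' s))
    (fun r _ => ((h.hasDerivAt_prod r).sub (h'.hasDerivAt_prod r)).hasDerivWithinAt)
    (C := M * (‖(q 0, p 0) - (q' 0, p' 0)‖ * Real.exp (M * s)))
    (fun r hr => (hH.norm_hamField_sub_le _ _).trans (mul_le_mul_of_nonneg_left
      ((hH.norm_orbit_sub_le h h' hr.1).trans (mul_le_mul_of_nonneg_left
        (Real.exp_le_exp.2 (mul_le_mul_of_nonneg_left hr.2.le hM)) (norm_nonneg _))) hM))
    s ⟨hs, le_rfl⟩
  rwa [sub_zero] at h1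

/-- The momentum grows at most exponentially along an orbit. -/
theorem norm_momentum_le {q p : ℝ → Conf d} (h : IsOrbit H q p) {s : ℝ} (hs : 0 ≤ s) :
    ‖p s‖ ≤ (‖p 0‖ + 3) * Real.exp (M * s) := by
  have hM := hH.bound_nonneg
  have h1 := norm_le_gronwallBound_of_norm_deriv_right_le (a := 0) (b := s) (f := p)
    (δ := ‖p 0‖) (K := M) (ε := 3 * M) (fun r _ => (h r).2.continuousAt.continuousWithinAt)
    (fun r _ => (h r).2.hasDerivWithinAt) le_rfl
    (fun r _ => by
      have := (norm_snd_le _).trans (hH.norm_hamField_le (q r) (p r))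
      simp only [hamField] at this
      linarith) s ⟨hs, le_rfl⟩
  refine h1.trans ?_
  have hexp := Real.exp_pos (M * s)
  by_cases h0 : M = 0
  · simp [h0, gronwallBound_K0]
  · rw [gronwallBound_of_K_ne_0 h0, mul_div_cancel_right₀ _ h0, sub_zero]
    nlinarith

end IsUniformlyConvexHamiltonian

end WeakKAM

end

/-! ### The twist property and short connecting orbits. -/

noncomputable section

/-- A strongly monotone Lipschitz map of a Hilbert space is onto. -/
theorem surjective_of_strongly_monotone {E : Type*} [NormedAddCommGroup E]
    [InnerProductSpace ℝ E] [CompleteSpace E] {F : E → E} {c L : ℝ} (hc : 0 < c)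
    (hmono : ∀ x y, c * ‖x - y‖ ^ 2 ≤ inner ℝ (F x - F y) (x - y))
    (hlip : ∀ x y, ‖F x - F y‖ ≤ L * ‖x - y‖) : Function.Surjective F := by
  intro z
  set L' := |L| + c with hL'
  have hL0 : 0 < L' := by positivity
  have hcL : c ≤ L' := by linarith [abs_nonneg L]
  have hlip' : ∀ x y, ‖F x - F y‖ ≤ L' * ‖x - y‖ := fun x y =>
    (hlip x y).trans (mul_le_mul_of_nonneg_right (by linarith [le_abs_self L]) (norm_nonneg _))
  set r := 1 - (c / L') ^ 2 with hr
  have hcL1 : c / L' ≤ 1 := (div_le_one hL0).2 hcL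
  have hcL0 : 0 < c / L' := by positivity
  have hr0 : 0 ≤ r := by nlinarith
  have hr1 : r < 1 := by nlinarith [pow_pos hcL0 2]
  -- This step minimises `1 - 2 * l * c + l ^ 2 * L' ^ 2`, the bound on the squared contraction
  -- ratio of `x ↦ x - l • (F x - z)`; the minimum is `r`.
  set l := c / L' ^ 2 with hl
  have hl0 : 0 < l := by positivity
  have hcontr : ContractingWith (NNReal.mk (Real.sqrt r) (Real.sqrt_nonneg r))
      (fun x => x - l • (F x - z)) := by
    refine ⟨?_, LipschitzWith.of_dist_le_mul fun x y => ?_⟩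
    · rw [← NNReal.coe_lt_coe, NNReal.coe_mk, NNReal.coe_one]
      exact (Real.sqrt_lt_sqrt hr0 hr1).trans_eq Real.sqrt_one
    · rw [dist_eq_norm, dist_eq_norm, NNReal.coe_mk]
      have h1 : x - l • (F x - z) - (y - l • (F y - z)) = (x - y) - l • (F x - F y) := by
        module
      rw [h1]
      refine abs_le_of_sq_le_sq' ?_ (by positivity) |>.2
      rw [norm_sub_sq_real, inner_smul_right, real_inner_comm, norm_smul, mul_pow, mul_pow,
        Real.sq_sqrt hr0, Real.norm_eq_abs, sq_abs]
      have h2 := hmono x y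
      have h3 : ‖F x - F y‖ ^ 2 ≤ L' ^ 2 * ‖x - y‖ ^ 2 := by
        rw [← mul_pow]; exact pow_le_pow_left₀ (norm_nonneg _) (hlip' x y) 2
      have h4 : l ^ 2 * ‖F x - F y‖ ^ 2 ≤ l ^ 2 * (L' ^ 2 * ‖x - y‖ ^ 2) := by gcongr
      have h5 := mul_le_mul_of_nonneg_left h2 hl0.le
      have h6 : l ^ 2 * L' ^ 2 = (c / L') ^ 2 := by rw [hl]; field_simp
      have h7 : l * c = (c / L') ^ 2 := by rw [hl]; field_simp
      have h8 : l ^ 2 * (L' ^ 2 * ‖x - y‖ ^ 2) = (c / L') ^ 2 * ‖x - y‖ ^ 2 := by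
        rw [← mul_assoc, h6]
      have h9 : l * (c * ‖x - y‖ ^ 2) = (c / L') ^ 2 * ‖x - y‖ ^ 2 := by
        rw [← mul_assoc, h7]
      rw [hr]
      linarith
  obtain ⟨x, hx, -⟩ := hcontr.exists_fixedPoint 0 (edist_ne_top _ _)
  refine ⟨x, ?_⟩
  have h1 : l • (F x - z) = 0 := sub_eq_self.1 hx
  exact sub_eq_zero.1 ((smul_eq_zero.1 h1).resolve_left hl0.ne')

namespace WeakKAM

variable {d : ℕ} {H : Conf d → Conf d → ℝ} {m M : ℝ}

/-- A time up to which the twist property holds. -/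
def twistTime (m M : ℝ) : ℝ := min 1 (m / (2 * (M ^ 2 * Real.exp M + 1)))

namespace IsUniformlyConvexHamiltonian

variable (hH : IsUniformlyConvexHamiltonian H m M)
include hH

theorem twistTime_pos : 0 < twistTime m M :=
  lt_min one_pos (div_pos hH.m_pos (by positivity))

/-- The twist property: for small times, the final position is a strongly monotone function of the
initial momentum. -/
theorem twist {q p q' p' : ℝ → Conf d} (h : IsOrbit H q p) (h' : IsOrbit H q' p')
    (h0 : q 0 = q' 0) {t : ℝ} (ht : 0 < t) (htm : t ≤ twistTime m M) :
    m / 2 * t * ‖p 0 - p' 0‖ ^ 2 ≤ inner ℝ (q t - q' t) (p 0 - p' 0) := by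
  have hM := hH.bound_nonneg
  set P := p 0 - p' 0 with hP
  have hder (s : ℝ) : HasDerivAt (fun s => inner ℝ (q s - q' s) P)
      (inner ℝ (dp H (q s) (p s) - dp H (q' s) (p' s)) P) s := by
    simpa using ((h s).1.sub (h' s).1).inner ℝ (hasDerivAt_const s P)
  have hbd : ∀ s, 0 < s → s < t →
      m / 2 * ‖P‖ ^ 2 ≤ inner ℝ (dp H (q s) (p s) - dp H (q' s) (p' s)) P := by
    intro s hs hst
    have hs1 : s ≤ 1 := hst.le.trans (htm.trans (min_le_left _ _))
    -- Changing the momentum by exactly `P` at fixed position contributes `m * ‖P‖ ^ 2`. What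
    -- remains is the drift of the difference of the orbits from its initial value `(0, P)`, which
    -- `twistTime` makes small enough to cost at most half of this.
    have h1 := hH.strongly_monotone (q s) (p s - P) P
    rw [sub_add_cancel] at h1
    have h2 := hH.norm_dp_sub_le (q s, p s - P) (q' s, p' s)
    have h3 := hH.norm_orbit_sub_sub_le h h' hs.le
    have e1 : (q s, p s - P) - (q' s, p' s) =
        ((q s, p s) - (q' s, p' s)) - ((q 0, p 0) - (q' 0, p' 0)) := by
      simp only [Prod.mk_sub_mk, h0, hP, sub_self, sub_zero]
      congr 1; abel
    have e2 : ‖(q 0, p 0) - (q' 0, p' 0)‖ = ‖P‖ := by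
      simp [Prod.norm_mk, h0, hP]
    rw [e1] at h2
    rw [e2] at h3
    have h4 : M * (M * (‖P‖ * Real.exp (M * s)) * s) ≤ m / 2 * ‖P‖ := by
      have h5 : Real.exp (M * s) ≤ Real.exp M := Real.exp_le_exp.2 (by nlinarith)
      have h6 : s ≤ m / (2 * (M ^ 2 * Real.exp M + 1)) :=
        hst.le.trans (htm.trans (min_le_right _ _))
      rw [le_div_iff₀ (by positivity)] at h6
      calc M * (M * (‖P‖ * Real.exp (M * s)) * s) = M ^ 2 * Real.exp (M * s) * s * ‖P‖ := by ring
        _ ≤ M ^ 2 * Real.exp M * s * ‖P‖ := by gcongr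
        _ ≤ m / 2 * ‖P‖ := mul_le_mul_of_nonneg_right (by linarith) (norm_nonneg _)
    have h7 : ‖dp H (q s) (p s - P) - dp H (q' s) (p' s)‖ ≤ m / 2 * ‖P‖ :=
      h2.trans ((mul_le_mul_of_nonneg_left h3 hM).trans h4)
    have h8 := (abs_le.1 (abs_real_inner_le_norm
      (dp H (q s) (p s - P) - dp H (q' s) (p' s)) P)).1
    have h9 := mul_le_mul_of_nonneg_right h7 (norm_nonneg P)
    rw [inner_sub_left] at h1 h8 ⊢
    nlinarith
  obtain ⟨c, hc, hs⟩ := exists_hasDerivAt_eq_slope _ _ ht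
    (fun s _ => (hder s).continuousAt.continuousWithinAt) (fun s _ => hder s)
  have h1 := hbd c hc.1 hc.2
  rw [hs, h0, sub_self, inner_zero_left, sub_zero, sub_zero, le_div_iff₀ ht] at h1
  linarith

/-- Shooting: by `twist` and Gronwall, the final position is a strongly monotone Lipschitz function
of the initial momentum, hence a bijection. -/
theorem uniqueOrbits_twistTime : UniqueOrbits H (twistTime m M) := by
  intro t ht htm q₀ q₁
  choose Q P hO hQ hP using fun p₀ => hH.exists_isOrbit q₀ p₀
  have hm := hH.m_pos
  have hsurj : Function.Surjective fun p₀ => Q p₀ t := by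
    refine surjective_of_strongly_monotone (c := m / 2 * t) (L := Real.exp (M * t))
      (by positivity) (fun x y => ?_) fun x y => ?_
    · have := hH.twist (hO x) (hO y) ((hQ x).trans (hQ y).symm) ht htm
      rwa [hP, hP] at this
    · have := (norm_fst_le _).trans (hH.norm_orbit_sub_le (hO x) (hO y) ht.le)
      rw [hQ, hQ, hP, hP, Prod.mk_sub_mk, Prod.mk_sub_mk, sub_self, Prod.norm_mk, norm_zero,
        max_eq_right (norm_nonneg _), mul_comm] at this
      exact this
  obtain ⟨p₀, hp₀⟩ := hsurj q₁
  refine ⟨(Q p₀, P p₀), ⟨hO p₀, hQ p₀, hp₀⟩, ?_⟩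
  rintro ⟨q, p⟩ ⟨hqp, hq0, hq1⟩
  simp only at hqp hq0 hq1 hp₀
  have h1 := hH.twist hqp (hO p₀) (hq0.trans (hQ p₀).symm) ht htm
  rw [hq1, hp₀, sub_self, inner_zero_left] at h1
  have h2 : ‖p 0 - P p₀ 0‖ = 0 := by
    by_contra hne
    have : 0 < m / 2 * t * ‖p 0 - P p₀ 0‖ ^ 2 := by positivity
    linarith
  obtain ⟨h3, h4⟩ := hH.isOrbit_unique hqp (hO p₀) (hq0.trans (hQ p₀).symm)
    (sub_eq_zero.1 (norm_eq_zero.1 h2))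
  rw [h3, h4]

/-- A priori bound: short orbits with bounded average speed have bounded momentum. -/
theorem exists_momentum_bound : ∃ C, 0 ≤ C ∧ ∀ q p, IsOrbit H q p → ∀ t, 0 < t →
    t ≤ twistTime m M → ‖q t - q 0‖ ≤ t → ∀ s, 0 ≤ s → s ≤ t → ‖p s‖ ≤ C := by
  have hM := hH.bound_nonneg
  have hm := hH.m_pos
  set D := 3 * M + M * (3 * Real.exp M) with hD
  have hD0 : 0 ≤ D := by positivity
  refine ⟨(2 / m * (1 + D) + 3) * Real.exp M, by positivity, fun q p h t ht htm hq s hs hst => ?_⟩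
  have ht1 : t ≤ 1 := htm.trans (min_le_left _ _)
  have hexp : ∀ r, r ≤ t → Real.exp (M * r) ≤ Real.exp M := fun r hr =>
    Real.exp_le_exp.2 (by nlinarith)
  -- The comparison orbit starts with zero momentum and has speed at most `D`; `twist` converts the
  -- gap between the endpoints into a bound on `p 0`.
  obtain ⟨q', p', h', hq', hp'⟩ := hH.exists_isOrbit (q 0) 0
  have h1 := hH.twist h h' hq'.symm ht htm
  rw [hp', sub_zero] at h1
  have h2 : ‖q' t - q' 0‖ ≤ D * (t - 0) := by
    refine norm_image_sub_le_of_norm_deriv_le_segment' (a := 0) (b := t)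
      (fun r _ => (h' r).1.hasDerivWithinAt) (fun r hr => ?_) t ⟨ht.le, le_rfl⟩
    refine (norm_fst_le _).trans ((hH.norm_hamField_le (q' r) (p' r)).trans ?_)
    have h3 := hH.norm_momentum_le h' hr.1
    rw [hp', norm_zero, zero_add] at h3
    have h4 := hexp r hr.2.le
    rw [hD]
    gcongr
    linarith
  have h3 : ‖q t - q' t‖ ≤ t * (1 + D) := by
    have : q t - q' t = (q t - q 0) - (q' t - q' 0) := by rw [hq']; abel
    rw [this]
    refine (norm_sub_le _ _).trans ?_
    linarith
  have h4 := real_inner_le_norm (q t - q' t) (p 0)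
  have h5 : ‖p 0‖ ≤ 2 / m * (1 + D) := by
    rcases (norm_nonneg (p 0)).eq_or_lt with h6 | h6
    · rw [← h6]; positivity
    · have h7 := mul_le_mul_of_nonneg_right h3 h6.le
      have h8 : (m / 2 * ‖p 0‖) * (t * ‖p 0‖) ≤ (1 + D) * (t * ‖p 0‖) := by nlinarith
      have h9 := le_of_mul_le_mul_right h8 (by positivity)
      rw [div_mul_eq_mul_div, le_div_iff₀ hm]
      linarith
  refine (hH.norm_momentum_le h hs).trans ?_
  have := hexp s hst
  gcongr

end IsUniformlyConvexHamiltonian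

end WeakKAM

end

/-! ### The action of orbits and the minimal action. -/

noncomputable section

namespace WeakKAM

variable {d : ℕ} {H : Conf d → Conf d → ℝ} {m M : ℝ}

/-- The integrand `p · ∂_p H - H` of the action along orbits. -/
def actionDensity (H : Conf d → Conf d → ℝ) (q p : Conf d) : ℝ :=
  inner ℝ p (dp H q p) - H q p

theorem IsOrbit.action_eq {q p : ℝ → Conf d} (h : IsOrbit H q p) (t : ℝ) :
    action H t (q, p) = ∫ s in (0 : ℝ)..t, actionDensity H (q s) (p s) := by
  simp only [action, actionDensity]
  exact intervalIntegral.integral_congr fun s _ => by simp only [(h s).1.deriv]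

/-- The generating function is the action of any connecting orbit. -/
theorem UniqueOrbits.genFun_eq {σ : ℝ} (hσ : UniqueOrbits H σ) {t : ℝ} (ht : 0 < t)
    (htσ : t ≤ σ) {q₀ q₁ : Conf d} {x : (ℝ → Conf d) × (ℝ → Conf d)}
    (hx : Connects H t q₀ q₁ x) : genFun H t q₀ q₁ = action H t x := by
  have h : ∃ x, Connects H t q₀ q₁ x := ⟨x, hx⟩
  rw [genFun, dif_pos h, (hσ t ht htσ q₀ q₁).unique h.choose_spec hx]

namespace IsUniformlyConvexHamiltonian

variable (hH : IsUniformlyConvexHamiltonian H m M)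
include hH

/-- The Fenchel inequality. -/
theorem inner_dp_le (q p w : Conf d) :
    inner ℝ w (dp H q p) ≤ actionDensity H q p + H q w := by
  have h := hH.add_inner_le q p w
  rw [inner_sub_right, real_inner_comm, real_inner_comm p] at h
  rw [actionDensity]
  linarith

theorem neg_le_actionDensity (q p : Conf d) : -M ≤ actionDensity H q p := by
  have h1 := hH.inner_dp_le q p 0
  have h2 := hH.upper_bound q 0
  simp at h1 h2
  linarith

theorem actionDensity_le (q p : Conf d) :
    actionDensity H q p ≤ ‖p‖ * (3 * M + M * ‖p‖) + M := by
  have h1 := real_inner_le_norm p (dp H q p)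
  have h2 := mul_le_mul_of_nonneg_left ((norm_fst_le _).trans (hH.norm_hamField_le q p))
    (norm_nonneg p)
  have h3 := hH.lower_bound q p
  have h4 : 0 ≤ m / 2 * ‖p‖ ^ 2 := by have := hH.m_pos; positivity
  simp only [hamField] at h2
  rw [actionDensity]
  linarith

theorem continuous_actionDensity {q p : ℝ → Conf d} (hq : Continuous q) (hp : Continuous p) :
    Continuous fun s => actionDensity H (q s) (p s) := by
  have h1 : Continuous fun s => dp H (q s) (p s) :=
    continuous_fst.comp (hH.contDiff_hamField.continuous.comp (hq.prodMk hp))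
  exact (hp.inner h1).sub (hH.continuous_uncurry.comp (hq.prodMk hp))

theorem continuous_actionDensity_orbit {q p : ℝ → Conf d} (h : IsOrbit H q p) :
    Continuous fun s => actionDensity H (q s) (p s) :=
  hH.continuous_actionDensity (continuous_iff_continuousAt.2 fun s => (h s).1.continuousAt)
    (continuous_iff_continuousAt.2 fun s => (h s).2.continuousAt)

/-- Rules out the default value `0` of `sInf` on an empty set of naturals. -/
theorem exists_admissible (t : ℝ) : Admissible H t (sInf {n | Admissible H t n}) := by
  refine Nat.sInf_mem (s := {n | Admissible H t n}) ?_
  obtain ⟨n, hn⟩ := exists_nat_gt (t / twistTime m M)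
  refine ⟨n + 1, by omega, twistTime m M, ?_, hH.uniqueOrbits_twistTime⟩
  rw [div_lt_iff₀ hH.twistTime_pos] at hn
  rw [div_lt_iff₀ (by positivity)]
  push_cast
  linarith [hH.twistTime_pos]

/-- Needed to make the real infimum in `brokenMin` a genuine lower bound. Each link costs at least
`-(M * t)`, by Fenchel's inequality at `w = 0`. -/
theorem bddBelow_brokenSums {σ t : ℝ} (hσ : UniqueOrbits H σ) (n : ℕ) (ht : 0 < t) (htσ : t ≤ σ)
    (q₀ q₁ : Conf d) : BddBelow (Set.range
      fun θ : {θ : Fin (n + 1) → Conf d // θ 0 = q₀ ∧ θ (Fin.last n) = q₁} =>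
        ∑ i : Fin n, genFun H t (θ.1 i.castSucc) (θ.1 i.succ)) := by
  refine ⟨∑ _i : Fin n, -(M * t), ?_⟩
  rintro _ ⟨θ, rfl⟩
  refine Finset.sum_le_sum fun i _ => ?_
  obtain ⟨⟨q, p⟩, hx, -⟩ := hσ t ht htσ (θ.1 i.castSucc) (θ.1 i.succ)
  rw [hσ.genFun_eq ht htσ hx, hx.1.action_eq]
  have h1 := intervalIntegral.integral_mono_on ht.le
    (intervalIntegrable_const (μ := volume) (c := -M))
    ((hH.continuous_actionDensity_orbit hx.1).intervalIntegrable _ _)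
    fun s _ => hH.neg_le_actionDensity (q s) (p s)
  rw [intervalIntegral.integral_const, smul_eq_mul] at h1
  linarith

/-- For short times, the minimal action is at most the action of an orbit. -/
theorem minAction_le_of_isOrbit {q p : ℝ → Conf d} (h : IsOrbit H q p) {t : ℝ} (ht : 0 < t)
    (htm : t < twistTime m M) :
    minAction H t (q 0) (q t) ≤ ∫ s in (0 : ℝ)..t, actionDensity H (q s) (p s) := by
  have hσ := hH.uniqueOrbits_twistTime
  have h1 : Admissible H t 1 := ⟨le_rfl, twistTime m M, by simpa using htm, hσ⟩
  have h2 : sInf {n | Admissible H t n} = 1 :=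
    le_antisymm (Nat.sInf_le h1) (hH.exists_admissible t).1
  rw [minAction, h2, brokenMin]
  have hb := hH.bddBelow_brokenSums hσ 1 (t := t / (1 : ℕ)) (by simpa using ht)
    (by simpa using htm.le) (q 0) (q t)
  refine (ciInf_le hb ⟨![q 0, q t], rfl, rfl⟩).trans (le_of_eq ?_)
  have h3 : Connects H t (q 0) (q t) (q, p) := ⟨h, rfl, rfl⟩
  rw [← h.action_eq, ← hσ.genFun_eq ht htm.le h3]
  simp

/-- A lower bound of the actions of all orbits is a lower bound of the minimal action. -/
theorem sub_le_minAction {u : Conf d → ℝ} {a : ℝ}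
    (hu : ∀ q p, IsOrbit H q p → ∀ t, 0 < t →
      u (q t) - u (q 0) ≤ (∫ s in (0 : ℝ)..t, actionDensity H (q s) (p s)) + a * t)
    {t : ℝ} (ht : 0 < t) (q₀ q₁ : Conf d) : u q₁ - u q₀ ≤ minAction H t q₀ q₁ + a * t := by
  -- This `σ` may exceed `twistTime m M`, which is why `hu` covers orbits of every duration.
  obtain ⟨hn, σ, hlt, hσ⟩ := hH.exists_admissible t
  rw [minAction]
  set n := sInf {n | Admissible H t n}
  have hn0 : (0 : ℝ) < n := by exact_mod_cast hn
  have htn : 0 < t / n := div_pos ht hn0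
  rw [← sub_le_iff_le_add, brokenMin]
  have hne : Nonempty {θ : Fin (n + 1) → Conf d // θ 0 = q₀ ∧ θ (Fin.last n) = q₁} := by
    refine ⟨fun i => if i = 0 then q₀ else q₁, by simp, ?_⟩
    refine if_neg fun h => ?_
    have := congrArg Fin.val h
    simp at this
    omega
  refine le_ciInf fun θ => ?_
  have h1 : ∀ i : Fin n, u (θ.1 i.succ) - u (θ.1 i.castSucc) ≤
      genFun H (t / n) (θ.1 i.castSucc) (θ.1 i.succ) + a * (t / n) := by
    intro i
    obtain ⟨⟨q, p⟩, hx, -⟩ := hσ _ htn hlt.le (θ.1 i.castSucc) (θ.1 i.succ)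
    have h2 := hu q p hx.1 _ htn
    rw [hσ.genFun_eq htn hlt.le hx, hx.1.action_eq]
    have e0 : q 0 = θ.1 i.castSucc := hx.2.1
    have e1 : q (t / n) = θ.1 i.succ := hx.2.2
    rwa [e0, e1] at h2
  have h3 := Finset.sum_le_sum fun i (_ : i ∈ Finset.univ) => h1 i
  rw [Finset.sum_add_distrib, Finset.sum_const, Finset.card_univ, Fintype.card_fin, nsmul_eq_mul,
    Finset.sum_sub_distrib] at h3
  -- Both sums are the sum over all vertices with one endpoint removed.
  have h4 : ∑ i : Fin n, u (θ.1 i.succ) - ∑ i : Fin n, u (θ.1 i.castSucc) = u q₁ - u q₀ := by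
    have e1 := Fin.sum_univ_succ fun i => u (θ.1 i)
    have e2 := Fin.sum_univ_castSucc fun i => u (θ.1 i)
    rw [θ.2.1] at e1
    rw [θ.2.2] at e2
    linarith
  have h5 : (n : ℝ) * (a * (t / n)) = a * t := by field_simp
  linarith

end IsUniformlyConvexHamiltonian

end WeakKAM

end

/-! ### Domination by the action: from almost everywhere sub-solutions, and to touching functions.
-/

noncomputable section

/-- The strict inequality on the sphere pushes the maximiser inside, where it is a local maximum and
can be tested in the viscosity sense. -/
theorem exists_isMax_mem_ball {E : Type*} [NormedAddCommGroup E] [ProperSpace E] {g : E → ℝ}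
    (hg : UpperSemicontinuous g) (x : E) {R : ℝ} (hR : 0 < R)
    (hlt : ∀ z, ‖z - x‖ = R → g z < g x) :
    ∃ z, ‖z - x‖ < R ∧ ∀ w, ‖w - x‖ ≤ R → g w ≤ g z := by
  obtain ⟨z, hz, hmax⟩ := UpperSemicontinuousOn.exists_isMaxOn
    ⟨x, Metric.mem_closedBall_self hR.le⟩ (isCompact_closedBall x R)
    (hg.upperSemicontinuousOn (Metric.closedBall x R))
  have hmax' : ∀ w, ‖w - x‖ ≤ R → g w ≤ g z := fun w hw => hmax (mem_closedBall_iff_norm.2 hw)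
  refine ⟨z, lt_of_le_of_ne (mem_closedBall_iff_norm.1 hz) fun h => ?_, hmax'⟩
  have h1 := hmax' x (by simpa using hR.le)
  have h2 := hlt z h
  linarith

/-- Subdivide the segment into pieces shorter than `τ` and telescope. -/
theorem lipschitzWith_of_short {E : Type*} [NormedAddCommGroup E] [NormedSpace ℝ E] {f : E → ℝ}
    {C τ : ℝ} (hC : 0 ≤ C) (hτ : 0 < τ)
    (h : ∀ x y, 0 < ‖y - x‖ → ‖y - x‖ < τ → f y - f x ≤ C * ‖y - x‖) :
    LipschitzWith C.toNNReal f := by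
  have h' : ∀ x y, ‖y - x‖ < τ → f y - f x ≤ C * ‖y - x‖ := by
    intro x y hxy
    rcases (norm_nonneg (y - x)).eq_or_lt with h0 | h0
    · rw [eq_comm, norm_eq_zero, sub_eq_zero] at h0
      simp [h0]
    · exact h x y h0 hxy
  refine LipschitzWith.of_le_add_mul _ fun y x => ?_
  rw [Real.coe_toNNReal _ hC, dist_eq_norm]
  obtain ⟨n, hn⟩ := exists_nat_gt (‖y - x‖ / τ)
  have hn0 : (0 : ℝ) < n := lt_of_le_of_lt (by positivity) hn
  rw [div_lt_iff₀ hτ] at hn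
  have h1 : ∀ i ∈ Finset.range n, f (x + ((i + 1 : ℕ) / n : ℝ) • (y - x)) -
      f (x + ((i : ℕ) / n : ℝ) • (y - x)) ≤ C * (‖y - x‖ / n) := by
    intro i _
    have e : x + ((i + 1 : ℕ) / n : ℝ) • (y - x) - (x + ((i : ℕ) / n : ℝ) • (y - x)) =
        (1 / n : ℝ) • (y - x) := by
      rw [add_sub_add_left_eq_sub, ← sub_smul]
      congr 1
      push_cast
      ring
    have e2 : ‖x + ((i + 1 : ℕ) / n : ℝ) • (y - x) - (x + ((i : ℕ) / n : ℝ) • (y - x))‖ =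
        ‖y - x‖ / n := by
      rw [e, norm_smul, Real.norm_eq_abs, abs_of_pos (by positivity)]
      ring
    have h2 := h' (x + ((i : ℕ) / n : ℝ) • (y - x)) (x + ((i + 1 : ℕ) / n : ℝ) • (y - x))
    rw [e2] at h2
    exact h2 (by rw [div_lt_iff₀ hn0]; linarith)
  have h2 := Finset.sum_le_sum h1
  rw [Finset.sum_range_sub (fun i : ℕ => f (x + ((i : ℕ) / n : ℝ) • (y - x))), Finset.sum_const,
    Finset.card_range, nsmul_eq_mul, div_self hn0.ne'] at h2
  simp only [one_smul, add_sub_cancel, Nat.cast_zero, zero_div, zero_smul, add_zero] at h2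
  have h3 : (n : ℝ) * (C * (‖y - x‖ / n)) = C * ‖y - x‖ := by field_simp
  linarith

theorem hasDerivAt_comp_of_differentiableAt {E : Type*} [NormedAddCommGroup E]
    [InnerProductSpace ℝ E] [CompleteSpace E] {u : E → ℝ} {c : ℝ → E} {c' : E} {s : ℝ}
    (hu : DifferentiableAt ℝ u (c s)) (hc : HasDerivAt c c' s) :
    HasDerivAt (fun s => u (c s)) (inner ℝ (gradient u (c s)) c') s := by
  rw [gradient, InnerProductSpace.toDual_symm_apply]
  exact hu.hasFDerivAt.comp_hasDerivAt s hc

namespace WeakKAM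

variable {d : ℕ} {H : Conf d → Conf d → ℝ} {m M : ℝ}

namespace IsUniformlyConvexHamiltonian

variable (hH : IsUniformlyConvexHamiltonian H m M)
include hH

/-- A Lipschitz almost everywhere sub-solution is dominated by the action of orbits. -/
theorem sub_le_action_of_ae {u : Conf d → ℝ} {K : NNReal} (hK : LipschitzWith K u) {a : ℝ}
    (hae : ∀ᵐ x ∂(volume : Measure (Conf d)), DifferentiableAt ℝ u x ∧ H x (gradient u x) ≤ a)
    {q p : ℝ → Conf d} (h : IsOrbit H q p) {t : ℝ} (ht : 0 < t) :
    u (q t) - u (q 0) ≤ (∫ s in (0 : ℝ)..t, actionDensity H (q s) (p s)) + a * t := by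
  have hqc : Continuous q := continuous_iff_continuousAt.2 fun s => (h s).1.continuousAt
  have hpc : Continuous p := continuous_iff_continuousAt.2 fun s => (h s).2.continuousAt
  have hg := hH.continuous_actionDensity hqc hpc
  -- almost every translate of the curve meets the bad set in a null set of times
  have hfub : ∀ᵐ y ∂(volume : Measure (Conf d)), ∀ᵐ s ∂(volume : Measure ℝ),
      DifferentiableAt ℝ u (q s + y) ∧ H (q s + y) (gradient u (q s + y)) ≤ a := by
    obtain ⟨N, hsub, hNm, hN0⟩ := exists_measurable_superset_of_null (ae_iff.1 hae)
    have h1 : ∀ᵐ s ∂(volume : Measure ℝ), ∀ᵐ y ∂(volume : Measure (Conf d)), q s + y ∉ N := by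
      refine Filter.Eventually.of_forall fun s => ?_
      rw [ae_iff]
      simp only [not_not]
      exact (measure_preimage_add volume (q s) N).trans hN0
    have hmeas : MeasurableSet {x : ℝ × Conf d | q x.1 + x.2 ∉ N} :=
      ((hqc.measurable.comp measurable_fst).add measurable_snd) hNm.compl
    filter_upwards [(Measure.ae_ae_comm hmeas).1 h1] with y hy
    filter_upwards [hy] with s hs
    by_contra hbad
    exact hs (hsub hbad)
  obtain ⟨R, hR⟩ := isCompact_Icc.exists_bound_of_continuousOn (s := Set.Icc 0 t)
    hqc.continuousOn
  obtain ⟨D, hD⟩ := isCompact_Icc.exists_bound_of_continuousOn (s := Set.Icc 0 t)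
    (f := fun s => dp H (q s) (p s))
    (continuous_fst.comp (hH.contDiff_hamField.continuous.comp (hqc.prodMk hpc))).continuousOn
  have hqL : LipschitzOnWith D.toNNReal q (Set.Icc 0 t) :=
    (convex_Icc 0 t).lipschitzOnWith_of_nnnorm_hasDerivWithin_le
      (fun s _ => (h s).1.hasDerivWithinAt) fun s hs => by
        rw [← NNReal.coe_le_coe]
        exact (hD s hs).trans (Real.le_coe_toNNReal D)
  have key : ∀ ε > 0, u (q t) - u (q 0) ≤
      (∫ s in (0 : ℝ)..t, actionDensity H (q s) (p s)) + (a + ε) * t + 2 * K * ε := by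
    intro ε hε
    have huc := ((isCompact_closedBall (0 : Conf d) (R + 1)).prod
      (isCompact_closedBall (0 : Conf d) K)).uniformContinuousOn_of_continuous
      hH.continuous_uncurry.continuousOn
    obtain ⟨δ, hδ, hδ'⟩ := Metric.uniformContinuousOn_iff.1 huc ε hε
    -- A set of full measure is dense, so a good translation can be taken small: below `δ` to move
    -- the base point of `H`, below `1` to stay in the compact set, below `ε` to control the
    -- endpoints.
    obtain ⟨y, hy, hyd⟩ := (Measure.dense_of_ae hfub).exists_mem_open
      (Metric.isOpen_ball (x := (0 : Conf d)) (ε := min δ (min 1 ε)))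
      ⟨0, Metric.mem_ball_self (by positivity)⟩
    rw [mem_ball_zero_iff, lt_min_iff, lt_min_iff] at hyd
    obtain ⟨hyδ, hy1, hyε⟩ := hyd
    have hfL : LipschitzOnWith (K * D.toNNReal) (fun s => u (q s + y)) (Set.uIcc 0 t) := by
      rw [Set.uIcc_of_le ht.le]
      refine hK.comp_lipschitzOnWith (g := fun s => q s + y) ?_
      intro s hs r hr
      rw [edist_add_right]
      exact hqL hs hr
    -- Absolute continuity allows the increment to be recovered from the almost everywhere
    -- derivative.
    have hac := hfL.absolutelyContinuousOnInterval
    have hint := hac.integral_deriv_eq_sub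
    have hgi : IntervalIntegrable (fun s => actionDensity H (q s) (p s) + (a + ε)) volume 0 t :=
      (hg.add continuous_const).intervalIntegrable _ _
    have hle := intervalIntegral.integral_mono_ae_restrict ht.le hac.intervalIntegrable_deriv hgi
      (by
        rw [Filter.EventuallyLE, ae_restrict_iff' measurableSet_Icc]
        filter_upwards [hy] with s hs hst
        have h1 := hasDerivAt_comp_of_differentiableAt hs.1 ((h s).1.add_const y)
        rw [h1.deriv]
        set w := gradient u (q s + y) with hw
        have hwK : ‖w‖ ≤ K := by
          rw [hw, gradient, LinearIsometryEquiv.norm_map]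
          exact norm_fderiv_le_of_lipschitz ℝ hK
        have h2 := hδ' (q s, w)
          ⟨mem_closedBall_zero_iff.2 ((hR s hst).trans (by linarith)),
            mem_closedBall_zero_iff.2 hwK⟩ (q s + y, w)
          ⟨mem_closedBall_zero_iff.2 ((norm_add_le _ _).trans (by linarith [hR s hst])),
            mem_closedBall_zero_iff.2 hwK⟩
          (by simpa [Prod.dist_eq, hδ] using hyδ)
        rw [Real.dist_eq] at h2
        have h3 := (abs_lt.1 h2).2
        simp only [Function.uncurry_apply_pair] at h3
        have h4 := hH.inner_dp_le (q s) (p s) w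
        linarith [hs.2])
    rw [hint, intervalIntegral.integral_add (hg.intervalIntegrable _ _)
      intervalIntegrable_const, intervalIntegral.integral_const, smul_eq_mul] at hle
    have hu1 : |u (q t) - u (q t + y)| ≤ K * ε := by
      have := hK.dist_le_mul (q t) (q t + y)
      rw [Real.dist_eq, dist_self_add_right] at this
      exact this.trans (by gcongr)
    have hu0 : |u (q 0) - u (q 0 + y)| ≤ K * ε := by
      have := hK.dist_le_mul (q 0) (q 0 + y)
      rw [Real.dist_eq, dist_self_add_right] at this
      exact this.trans (by gcongr)
    have h5 := (abs_le.1 hu1).2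
    have h6 := (abs_le.1 hu0).1
    linarith
  refine le_of_forall_pos_le_add fun ε hε => ?_
  have hpos : 0 < t + 2 * K := by positivity
  have h1 := key (ε / (t + 2 * K)) (by positivity)
  have h2 : ε / (t + 2 * K) * t + 2 * K * (ε / (t + 2 * K)) = ε := by field_simp
  linarith

/-- A function dominated by the action of short orbits is a sub-solution wherever it is touched
from above by a differentiable function. -/
theorem le_of_dominated {u : Conf d → ℝ} {a τ : ℝ} (hτ : 0 < τ)
    (hu : ∀ q p, IsOrbit H q p → ∀ t, 0 < t → t < τ →
      u (q t) - u (q 0) ≤ (∫ s in (0 : ℝ)..t, actionDensity H (q s) (p s)) + a * t)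
    {v : Conf d → ℝ} {x : Conf d} (hv : DifferentiableAt ℝ v x)
    (hmin : IsLocalMin (fun θ => v θ - u θ) x) : H x (gradient v x) ≤ a := by
  obtain ⟨q, p, h, hq, hp⟩ := hH.exists_isOrbit x (gradient v x)
  have hg := hH.continuous_actionDensity_orbit h
  set g := fun s => actionDensity H (q s) (p s) with hgdef
  have hder : HasDerivAt (fun s => v (q s) - (∫ r in (0 : ℝ)..s, g r) - a * s)
      (H x (gradient v x) - a) 0 := by
    have h1 := hasDerivAt_comp_of_differentiableAt (hq ▸ hv) (h 0).1
    have h2 := intervalIntegral.integral_hasDerivAt_right (hg.intervalIntegrable 0 0)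
      (hg.stronglyMeasurableAtFilter volume _) hg.continuousAt
    have h3 : HasDerivAt (fun s : ℝ => a * s) a 0 := by
      simpa using (hasDerivAt_id (0 : ℝ)).const_mul a
    refine ((h1.sub h2).sub h3).congr_deriv ?_
    simp only [hgdef, actionDensity, hq, hp]
    ring
  -- Only the past is used: domination with final point `x` bounds `u (q s)` from below, and
  -- touching from above transfers this bound to `v (q s)`.
  have hev : ∀ᶠ s in nhdsWithin (0 : ℝ) (Set.Iio 0),
      slope (fun s => v (q s) - (∫ r in (0 : ℝ)..s, g r) - a * s) 0 s ≤ 0 := by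
    have h1 : ∀ᶠ s in nhds (0 : ℝ), v x - u x ≤ v (q s) - u (q s) := by
      have := (h 0).1.continuousAt.tendsto
      rw [hq] at this
      exact this.eventually hmin
    filter_upwards [self_mem_nhdsWithin, nhdsWithin_le_nhds h1,
      nhdsWithin_le_nhds (lt_mem_nhds (neg_lt_zero.2 hτ))] with s hs hs1 hs2
    have hs0 : s < 0 := hs
    have h2 := hu _ _ (h.comp_add_const s) (-s) (by linarith) (by linarith)
    have h3 : ∫ r in (0 : ℝ)..(-s), actionDensity H (q (r + s)) (p (r + s)) =
        -∫ r in (0 : ℝ)..s, g r := by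
      rw [intervalIntegral.integral_comp_add_right g s, intervalIntegral.integral_symm]
      simp
    rw [h3, neg_add_cancel, zero_add, hq] at h2
    rw [slope_def_field]
    refine div_nonpos_of_nonneg_of_nonpos ?_ (by linarith)
    simp only [hq, intervalIntegral.integral_same]
    linarith
  have h4 := le_of_tendsto ((hasDerivAt_iff_tendsto_slope.1 hder).mono_left
    (nhdsWithin_mono (s := Set.Iio 0) _ fun s (hs : s < 0) => hs.ne)) hev
  linarith

/-- A function dominated by the action of short orbits is Lipschitz. -/
theorem exists_lipschitzWith_of_dominated {u : Conf d → ℝ} {a : ℝ}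
    (hu : ∀ q p, IsOrbit H q p → ∀ t, 0 < t → t < twistTime m M →
      u (q t) - u (q 0) ≤ (∫ s in (0 : ℝ)..t, actionDensity H (q s) (p s)) + a * t) :
    ∃ K, LipschitzWith K u := by
  have hM := hH.bound_nonneg
  obtain ⟨C, hC0, hC⟩ := hH.exists_momentum_bound
  refine ⟨_, lipschitzWith_of_short (C := C * (3 * M + M * C) + M + |a|) (by positivity)
    hH.twistTime_pos fun x y hpos hlt => ?_⟩
  -- Travel time equal to the distance gives average speed one, as `exists_momentum_bound` requires.
  obtain ⟨⟨q, p⟩, ⟨h, hq0, hq1⟩, -⟩ := hH.uniqueOrbits_twistTime _ hpos hlt.le x y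
  simp only at h hq0 hq1
  have h1 := hu q p h _ hpos hlt
  have h2 : ∫ s in (0 : ℝ)..‖y - x‖, actionDensity H (q s) (p s) ≤
      ∫ _ in (0 : ℝ)..‖y - x‖, (C * (3 * M + M * C) + M) := by
    refine intervalIntegral.integral_mono_on hpos.le
      ((hH.continuous_actionDensity_orbit h).intervalIntegrable _ _)
      intervalIntegrable_const fun s hs => (hH.actionDensity_le _ _).trans ?_
    have h3 := hC q p h _ hpos hlt.le (by rw [hq0, hq1]) s hs.1 hs.2
    gcongr
  rw [intervalIntegral.integral_const, smul_eq_mul, sub_zero] at h2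
  rw [hq0, hq1] at h1
  have h4 := mul_le_mul_of_nonneg_right (le_abs_self a) hpos.le
  linarith

end IsUniformlyConvexHamiltonian

end WeakKAM

end

/-! ### Viscosity sub-solutions: Lipschitz regularity and points of differentiability. -/

noncomputable section

namespace WeakKAM

variable {d : ℕ} {H : Conf d → Conf d → ℝ} {m M a : ℝ} {u : Conf d → ℝ}

theorem hasFDerivAt_norm_sub_sq (x z : Conf d) :
    HasFDerivAt (fun w => ‖w - x‖ ^ 2) (InnerProductSpace.toDual ℝ (Conf d) ((2 : ℝ) • (z - x)))
      z := by
  have h := ((hasFDerivAt_id z).sub_const x).norm_sq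
  refine h.congr_fderiv ?_
  ext w
  simp

theorem contDiff_norm_sub_sq (x : Conf d) : ContDiff ℝ 1 fun w : Conf d => ‖w - x‖ ^ 2 :=
  (contDiff_id.sub contDiff_const).norm_sq ℝ

/-- At an interior maximum of `u - v`, the sub-solution property tests `H` at `dv`. -/
theorem IsViscositySubsolution.le_of_ball_max (hu : IsViscositySubsolution H a u)
    {v : Conf d → ℝ} (hv : ContDiff ℝ 1 v) {x z g : Conf d} {R : ℝ} (hz : ‖z - x‖ < R)
    (hg : HasFDerivAt v (InnerProductSpace.toDual ℝ (Conf d) g) z)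
    (hmax : ∀ w, ‖w - x‖ ≤ R → u w - v w ≤ u z - v z) : H z g ≤ a := by
  have h1 : IsLocalMin (fun w => v w - u w) z := by
    have : Metric.ball x R ∈ nhds z := Metric.isOpen_ball.mem_nhds (mem_ball_iff_norm.2 hz)
    filter_upwards [this] with w hw
    have := hmax w (mem_ball_iff_norm.1 hw).le
    linarith
  have h2 := hu.2 v hv z h1
  have h3 : gradient v z = g := by
    rw [gradient, hg.fderiv, LinearIsometryEquiv.symm_apply_apply]
  rwa [h3] at h2

namespace IsUniformlyConvexHamiltonian

variable (hH : IsUniformlyConvexHamiltonian H m M)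
include hH

theorem exists_coercive (a : ℝ) : ∃ K, 0 < K ∧ ∀ q p, K ≤ ‖p‖ → a < H q p := by
  have hM := hH.bound_nonneg
  have hm := hH.m_pos
  refine ⟨1 + 2 * (|a| + M + 1) / m, by positivity, fun q p hp => ?_⟩
  have h0 : 0 ≤ 2 * (|a| + M + 1) / m := by positivity
  have h1 : ‖p‖ ≤ ‖p‖ ^ 2 := by nlinarith
  have h2 : 2 * (|a| + M + 1) / m ≤ ‖p‖ ^ 2 := by linarith
  rw [div_le_iff₀ hm] at h2
  have h3 := hH.lower_bound q p
  have h4 := le_abs_self a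
  linarith

/-- Viscosity sub-solutions are Lipschitz. -/
theorem exists_lipschitzWith_of_viscosity (hu : IsViscositySubsolution H a u) :
    ∃ K, LipschitzWith K u := by
  obtain ⟨K, hK0, hK⟩ := hH.exists_coercive a
  refine ⟨K.toNNReal, LipschitzWith.of_le_add_mul _ fun y x => ?_⟩
  rw [Real.coe_toNNReal _ hK0.le, dist_eq_norm]
  set R := ‖y - x‖ + 1 with hR
  have hR0 : 0 < R := by positivity
  obtain ⟨B', hB'⟩ := UpperSemicontinuousOn.bddAbove_of_isCompact
    (isCompact_closedBall x R) (hu.1.upperSemicontinuousOn (Metric.closedBall x R))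
  set B := |B' - u x| + 1 with hB
  have hB0 : 0 < B := by positivity
  have hbd : ∀ z, ‖z - x‖ ≤ R → u z ≤ B' := fun z hz =>
    hB' ⟨z, mem_closedBall_iff_norm.2 hz, rfl⟩
  have key : ∀ n : ℕ, u y ≤ u x + K * ‖y - x‖ + B * (‖y - x‖ ^ 2 / R ^ 2) ^ (n + 1) := by
    intro n
    -- The second term equals `B` on the sphere of radius `R`, forcing an interior maximum of `u -
    -- φ`; at `y`, strictly inside, it vanishes as `n` grows.
    set φ : Conf d → ℝ := fun z => K * ‖z - x‖ + B * (‖z - x‖ ^ 2 / R ^ 2) ^ (n + 1) with hφ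
    have hφc : Continuous φ := by fun_prop
    have hφx : φ x = 0 := by simp [hφ]
    obtain ⟨z, hzR, hmax⟩ := exists_isMax_mem_ball (g := fun z => u z + -φ z)
      (hu.1.add hφc.neg.upperSemicontinuous) x hR0 (by
        intro z hz
        have h1 := hbd z hz.le
        have h2 : φ z = K * R + B := by
          simp only [hφ]
          rw [hz, div_self (by positivity), one_pow, mul_one]
        have h3 := le_abs_self (B' - u x)
        have h4 : 0 < K * R := by positivity
        simp only [h2, hφx]
        linarith)
    have hzx : z = x := by
      by_contra hne
      have hr : 0 < ‖z - x‖ := norm_sub_pos_iff.2 hne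
      set r := ‖z - x‖ with hrdef
      -- The cone is not `C¹` at `x`. It is replaced by a paraboloid lying above it and tangent
      -- along `‖w - x‖ = r`; at `z` the gradient of `v` has norm at least `K`, contradicting
      -- coercivity.
      set v : Conf d → ℝ := fun w => K / (2 * r) * ‖w - x‖ ^ 2 + K * r / 2 +
        B * (‖w - x‖ ^ 2 / R ^ 2) ^ (n + 1) with hv
      have hs := contDiff_norm_sub_sq x
      have hvC : ContDiff ℝ 1 v :=
        ((contDiff_const.mul hs).add contDiff_const).add
          (contDiff_const.mul ((hs.div_const _).pow _))
      have hvz : v z = φ z := by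
        simp only [hv, hφ, ← hrdef]
        field_simp
        ring
      have hvφ : ∀ w, φ w ≤ v w := by
        intro w
        simp only [hv, hφ]
        have h1 : K * ‖w - x‖ ≤ K / (2 * r) * ‖w - x‖ ^ 2 + K * r / 2 := by
          have h2 : K / (2 * r) * ‖w - x‖ ^ 2 + K * r / 2 - K * ‖w - x‖ =
              K / (2 * r) * (‖w - x‖ - r) ^ 2 := by field_simp; ring
          have h3 : 0 ≤ K / (2 * r) * (‖w - x‖ - r) ^ 2 := by positivity
          linarith
        linarith
      set c := K / (2 * r) + B * ((n + 1 : ℕ) * (r ^ 2 / R ^ 2) ^ n * (R ^ 2)⁻¹) with hc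
      have hgrad : HasFDerivAt v
          (InnerProductSpace.toDual ℝ (Conf d) (c • (2 : ℝ) • (z - x))) z := by
        have h1 : HasDerivAt (fun ρ : ℝ => K / (2 * r) * ρ + K * r / 2 +
            B * (ρ / R ^ 2) ^ (n + 1)) c (‖z - x‖ ^ 2) := by
          have h2 := (((hasDerivAt_id (‖z - x‖ ^ 2)).const_mul (K / (2 * r))).add_const
            (K * r / 2)).add ((((hasDerivAt_id (‖z - x‖ ^ 2)).div_const (R ^ 2)).pow
              (n + 1)).const_mul B)
          refine h2.congr_deriv ?_
          simp [hc, ← hrdef]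
        have h3 := h1.comp_hasFDerivAt z (hasFDerivAt_norm_sub_sq x z)
        refine h3.congr_fderiv ?_
        rw [map_smul (InnerProductSpace.toDual ℝ (Conf d)) c]
      have h1 : H z (c • (2 : ℝ) • (z - x)) ≤ a := by
        refine hu.le_of_ball_max hvC hzR hgrad fun w hw => ?_
        have := hmax w hw
        have := hvφ w
        rw [hvz]
        linarith
      have hcK : K / (2 * r) ≤ c := by
        rw [hc]
        exact le_add_of_nonneg_right (by positivity)
      have hc0 : 0 < c := lt_of_lt_of_le (by positivity) hcK
      refine absurd h1 (not_le.2 (hK _ _ ?_))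
      rw [norm_smul, norm_smul, Real.norm_eq_abs, abs_of_pos hc0, Real.norm_two, ← hrdef]
      rw [div_le_iff₀ (by positivity)] at hcK
      linarith
    have h5 := hmax y (by rw [hR]; linarith)
    rw [hzx, hφx] at h5
    simp only [hφ] at h5
    linarith
  have hlt : ‖y - x‖ ^ 2 / R ^ 2 < 1 := by
    rw [div_lt_one (by positivity)]
    exact pow_lt_pow_left₀ (by rw [hR]; linarith) (norm_nonneg _) two_ne_zero
  have hlim : Filter.Tendsto
      (fun n : ℕ => u x + K * ‖y - x‖ + B * (‖y - x‖ ^ 2 / R ^ 2) ^ (n + 1)) Filter.atTop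
      (nhds (u x + K * ‖y - x‖ + B * 0)) :=
    (((tendsto_pow_atTop_nhds_zero_of_lt_one (by positivity) hlt).comp
      (Filter.tendsto_add_atTop_nat 1)).const_mul B).const_add _
  have := ge_of_tendsto' hlim key
  linarith

/-- Viscosity sub-solutions satisfy the inequality at points of differentiability. -/
theorem le_of_viscosity (hu : IsViscositySubsolution H a u) {x : Conf d}
    (hx : DifferentiableAt ℝ u x) : H x (gradient u x) ≤ a := by
  set g := gradient u x with hg
  have hclosed : IsClosed {y : Conf d × Conf d | Function.uncurry H y ≤ a} :=
    isClosed_le hH.continuous_uncurry continuous_const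
  suffices (x, g) ∈ closure {y : Conf d × Conf d | Function.uncurry H y ≤ a} from
    hclosed.closure_subset this
  refine Metric.mem_closure_iff.2 fun ε hε => ?_
  set η := ε / 4 with hη
  have hη0 : 0 < η := by positivity
  have hlo : ∀ᶠ w in nhds x, ‖u w - u x - inner ℝ g (w - x)‖ ≤ η / 2 * ‖w - x‖ := by
    have h1 := hx.hasFDerivAt.isLittleO.def (half_pos hη0)
    filter_upwards [h1] with w hw
    rwa [hg, gradient, InnerProductSpace.toDual_symm_apply]
  obtain ⟨ρ₀, hρ₀, hball⟩ := Metric.eventually_nhds_iff.1 hlo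
  set ρ := min (ρ₀ / 2) (ε / 2) with hρdef
  have hρ : 0 < ρ := by positivity
  have hρ1 : ρ < ρ₀ := (min_le_left _ _).trans_lt (by linarith)
  -- On the sphere of radius `ρ` the penalty `η * ρ` beats the first-order error `η * ρ / 2`, while
  -- inside it changes the gradient by at most `2 * η`.
  set v : Conf d → ℝ := fun w => inner ℝ g (w - x) + η / ρ * ‖w - x‖ ^ 2 with hv
  have hvC : ContDiff ℝ 1 v :=
    (contDiff_const.inner ℝ (contDiff_id.sub contDiff_const)).add
      (contDiff_const.mul (contDiff_norm_sub_sq x))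
  obtain ⟨z, hz, hmax⟩ := exists_isMax_mem_ball (g := fun w => u w + -v w)
    (hu.1.add hvC.continuous.neg.upperSemicontinuous) x hρ (by
      intro w hw
      have h1 := hball (y := w) (by rwa [dist_eq_norm, hw])
      rw [Real.norm_eq_abs, hw] at h1
      have h2 := (abs_le.1 h1).2
      have h3 : η / ρ * ρ ^ 2 = η * ρ := by field_simp
      have h4 : 0 < η * ρ := by positivity
      simp only [hv, hw, h3, sub_self, inner_zero_right, norm_zero]
      simp only [ne_eq, OfNat.ofNat_ne_zero, not_false_eq_true, zero_pow, mul_zero, add_zero,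
        neg_zero]
      linarith)
  have hgrad : HasFDerivAt v (InnerProductSpace.toDual ℝ (Conf d)
      (g + (η / ρ) • (2 : ℝ) • (z - x))) z := by
    have h1 : HasFDerivAt (fun w => inner ℝ g (w - x)) (InnerProductSpace.toDual ℝ (Conf d) g) z :=
      (InnerProductSpace.toDual ℝ (Conf d) g).hasFDerivAt.comp (f := fun w => w - x) z
        ((hasFDerivAt_id z).sub_const x)
    refine (h1.add ((hasFDerivAt_norm_sub_sq x z).const_mul (η / ρ))).congr_fderiv ?_
    rw [map_add, map_smul (InnerProductSpace.toDual ℝ (Conf d)) (η / ρ)]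
  refine ⟨(z, g + (η / ρ) • (2 : ℝ) • (z - x)), hu.le_of_ball_max hvC hz hgrad fun w hw => ?_, ?_⟩
  · have := hmax w hw
    linarith
  · rw [Prod.dist_eq, max_lt_iff, dist_self_add_right, norm_smul, norm_smul, Real.norm_two,
      Real.norm_eq_abs, abs_of_pos (by positivity), dist_comm, dist_eq_norm]
    have h1 : ρ ≤ ε / 2 := min_le_right _ _
    refine ⟨by simp only; linarith, ?_⟩
    calc η / ρ * (2 * ‖z - x‖) ≤ η / ρ * (2 * ρ) := by gcongr
      _ = 2 * η := by field_simp
      _ < ε := by rw [hη]; linarith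

end IsUniformlyConvexHamiltonian

end WeakKAM

end

/-! ### The equivalence of the five properties. -/

theorem mainTheorem7 {d : ℕ} (H : WeakKAM.Conf d → WeakKAM.Conf d → ℝ) (m M : ℝ)
    (hH : WeakKAM.IsUniformlyConvexHamiltonian H m M) (a : ℝ) (u : WeakKAM.Conf d → ℝ) :
    List.TFAE [
      (∃ K, LipschitzWith K u) ∧
        ∀ᵐ q ∂(volume : Measure (WeakKAM.Conf d)),
          DifferentiableAt ℝ u q ∧ H q (gradient u q) ≤ a,
      ∀ q₀ q₁ t, 0 < t → u q₁ - u q₀ ≤ WeakKAM.minAction H t q₀ q₁ + a * t,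
      ∀ t : ℝ, 0 ≤ t → ∀ q, (u q : EReal) ≤ WeakKAM.laxOleinik H t u q + ((t * a : ℝ) : EReal),
      WeakKAM.IsViscositySubsolution H a u,
      (∃ K, LipschitzWith K u) ∧
        ∀ q, DifferentiableAt ℝ u q → H q (gradient u q) ≤ a] := by
  have hdom : (∀ q₀ q₁ t, 0 < t → u q₁ - u q₀ ≤ WeakKAM.minAction H t q₀ q₁ + a * t) →
      ∀ q p, WeakKAM.IsOrbit H q p → ∀ t, 0 < t → t < WeakKAM.twistTime m M →
        u (q t) - u (q 0) ≤
          (∫ s in (0 : ℝ)..t, WeakKAM.actionDensity H (q s) (p s)) + a * t := by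
    intro h q p hqp t ht htm
    have h1 := h (q 0) (q t) t ht
    have h2 := hH.minAction_le_of_isOrbit hqp ht htm
    linarith
  have hloc {v : WeakKAM.Conf d → ℝ} {q : WeakKAM.Conf d}
      (h : ∀ q₀ q₁ t, 0 < t → u q₁ - u q₀ ≤ WeakKAM.minAction H t q₀ q₁ + a * t)
      (hv : DifferentiableAt ℝ v q) (hmin : IsLocalMin (fun θ => v θ - u θ) q) :
      H q (gradient v q) ≤ a := hH.le_of_dominated hH.twistTime_pos (hdom h) hv hmin
  tfae_have 1 → 2 := by
    rintro ⟨⟨K, hK⟩, hae⟩ q₀ q₁ t ht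
    exact hH.sub_le_minAction (fun q p h s hs => hH.sub_le_action_of_ae hK hae h hs) ht q₀ q₁
  tfae_have 2 → 3 := by
    intro h t ht q
    rcases ht.eq_or_lt with rfl | ht0
    · simp [WeakKAM.laxOleinik]
    · rw [WeakKAM.laxOleinik, if_neg ht0.ne']
      have h1 : ((u q - t * a : ℝ) : EReal) ≤
          ⨅ θ, ((u θ + WeakKAM.minAction H t θ q : ℝ) : EReal) := by
        refine le_iInf fun θ => EReal.coe_le_coe_iff.2 ?_
        have := h θ q t ht0
        linarith
      calc (u q : EReal) = ((u q - t * a : ℝ) : EReal) + ((t * a : ℝ) : EReal) := by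
            rw [← EReal.coe_add, sub_add_cancel]
        _ ≤ _ := by gcongr
  tfae_have 3 → 2 := by
    intro h q₀ q₁ t ht
    have h1 := h t ht.le q₁
    rw [WeakKAM.laxOleinik, if_neg ht.ne'] at h1
    have h2 : (u q₁ : EReal) ≤
        ((u q₀ + WeakKAM.minAction H t q₀ q₁ : ℝ) : EReal) + ((t * a : ℝ) : EReal) :=
      h1.trans (by gcongr; exact iInf_le _ q₀)
    rw [← EReal.coe_add, EReal.coe_le_coe_iff] at h2
    linarith
  tfae_have 2 → 4 := by
    intro h
    obtain ⟨K, hK⟩ := hH.exists_lipschitzWith_of_dominated (hdom h)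
    exact ⟨hK.continuous.upperSemicontinuous, fun v hv q hmin =>
      hloc h (hv.differentiable (by norm_num) q) hmin⟩
  tfae_have 4 → 5 := fun h =>
    ⟨hH.exists_lipschitzWith_of_viscosity h, fun q hq => hH.le_of_viscosity h hq⟩
  tfae_have 5 → 1 := by
    rintro ⟨⟨K, hK⟩, h⟩
    refine ⟨⟨K, hK⟩, ?_⟩
    filter_upwards [hK.ae_differentiableAt] with q hq using ⟨hq, h q hq⟩
  tfae_finish
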